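/- Work over the field $\mathbb{Q}(q)$ of rational functions in $q$. For $m\in\mathbb{Z}$ put $[m]_q=(q^m-1)/(q-1)$. The Carlitz $q$-Bernoulli numbers $(\beta_n)_{n\ge 0}$ in $\mathbb{Q}(q)$ are defined by the relations $$q\sum_{k=0}^{n}\binom{n}{k}q^k\beta_k-\beta_n=\begin{cases}q-1 & n=0,\\ 1 & n=1,\\ 0 & n>1,\end{cases}$$ and $\Psi$ is the $\mathbb{Q}(q)$-linear form on $\mathbb{Q}(q)[x]$ with $\Psi(x^n)=\beta_n$ for all $n\ge 0$. Put $$\operatorname{Asc}(x,m)=\prod_{i=1}^{m}([i]_q+q^i x)\ \ (m\ge 0),\qquad \operatorname{Desc}(x,-1)=-\frac1x,\qquad \operatorname{Desc}(x,m)=\prod_{i=1}^{m}([i]_q-x)\ \ (m\ge 0),$$ where empty products equal $1$. Let $a,b\ge 1$ and $c,d\ge 0$ be integers, and for $n\ge 0$ let $M(n)$ be the $n\times n$ matrix with entries $$\Psi\bigl(x^{i+j+2}\operatorname{Asc}(x,a-1)\operatorname{Asc}(x,b-1)\operatorname{Desc}(x,c-1)\operatorname{Desc}(x,d-1)\bigr),\qquad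 0\le i,j\le n-1$$ (the argument of $\Psi$ is always a polynomial in $x$). Let $$C_{a,b,c,d}=\Psi\bigl(x^{2}\operatorname{Asc}(x,a-1)\operatorname{Asc}(x,b-1)\operatorname{Desc}(x,c-1)\operatorname{Desc}(x,d-1)\bigr).$$ Then $$\det M(n)=(-q^{c+d})^{\binom n2}\,q^{\binom n3}\,C_{a,b,c,d}^{\,n}\prod_{i=1}^{n-1}\left(\frac{[i]_q\,[a+c+i-1]_q\,[b+c+i-1]_q\,[a+d+i-1]_q\,[b+d+i-1]_q\,[a+b+c+d+i-2]_q}{[a+b+c+d+2i-3]_q\,[a+b+c+d+2i-2]_q^{2}\,[a+b+c+d+2i-1]_q}\right)^{n-i}.$$ -/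

import Mathlib

open Polynomial
open scoped LaurentPolynomial

namespace QBernoulli

noncomputable section

/-- The field `ℚ(q)` of rational functions in one variable `q`. -/
abbrev Kq : Type := RatFunc ℚ

/-- The variable `q` of `ℚ(q)`. -/
def q : Kq := RatFunc.X

/-- The `q`-integer `[n]_q = (q ^ n - 1) / (q - 1)`, for `n ∈ ℤ`. -/
def qInt (n : ℤ) : Kq := (q ^ n - 1) / (q - 1)

/-- The right-hand side of the Carlitz relations: `q - 1, 1, 0, 0, …`. -/
def carlitzRhs (n : ℕ) : Kq := if n = 0 then q - 1 else if n = 1 then 1 else 0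

/-- The Carlitz `q`-Bernoulli numbers `β_n`: the relation
`q (q β + 1) ^ n - β ^ n = carlitzRhs n`, in which powers of `β` become indices after expansion,
solved for `β_n` (see `carlitz_relation` and `eq_beta_of_carlitz_relation`). -/
def beta (n : ℕ) : Kq :=
  (carlitzRhs n - q * ∑ k : Fin n, (n.choose k : Kq) * q ^ (k : ℕ) * beta k) / (q ^ (n + 1) - 1)

theorem q_pow_sub_one_ne_zero (n : ℕ) : q ^ (n + 1) - 1 ≠ 0 := by
  have h : (Polynomial.X ^ (n + 1) - 1 : ℚ[X]) ≠ 0 := by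
    simpa using Polynomial.X_pow_sub_C_ne_zero (Nat.succ_pos n) (1 : ℚ)
  have h2 := (map_ne_zero_iff (algebraMap ℚ[X] Kq) (RatFunc.algebraMap_injective ℚ)).2 h
  simpa [q, RatFunc.algebraMap_X] using h2

/-- `β` satisfies the Carlitz relations. -/
theorem carlitz_relation (n : ℕ) :
    q * ∑ k ∈ Finset.range (n + 1), (n.choose k : Kq) * q ^ k * beta k - beta n
      = carlitzRhs n := by
  have h := q_pow_sub_one_ne_zero n
  have hb : beta n * (q ^ (n + 1) - 1) = carlitzRhs n
      - q * ∑ k ∈ Finset.range n, (n.choose k : Kq) * q ^ k * beta k := by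
    rw [beta, div_mul_cancel₀ _ h,
      Finset.sum_range (fun k => (n.choose k : Kq) * q ^ k * beta k)]
  rw [Finset.sum_range_succ, Nat.choose_self, Nat.cast_one]
  linear_combination hb

/-- The Carlitz relations determine `β`. -/
theorem eq_beta_of_carlitz_relation (f : ℕ → Kq)
    (hf : ∀ n, q * ∑ k ∈ Finset.range (n + 1), (n.choose k : Kq) * q ^ k * f k - f n
      = carlitzRhs n) (n : ℕ) : f n = beta n := by
  induction n using Nat.strong_induction_on with
  | _ n ih =>
    have h1 := hf n
    have h2 := carlitz_relation n
    rw [Finset.sum_range_succ, Nat.choose_self, Nat.cast_one] at h1 h2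
    rw [Finset.sum_congr rfl (fun k hk => by rw [ih k (Finset.mem_range.1 hk)])] at h1
    apply mul_right_cancel₀ (q_pow_sub_one_ne_zero n)
    linear_combination h1 - h2

/-- The linear form `Ψ` on `ℚ(q)[x]` with `Ψ (x ^ n) = β_n`. -/
def Psi : Kq[X] →ₗ[Kq] Kq := (Polynomial.basisMonomials Kq).constr Kq beta

theorem Psi_X_pow (n : ℕ) : Psi (X ^ n) = beta n := by
  have h := (Polynomial.basisMonomials Kq).constr_basis Kq beta n
  rw [Polynomial.coe_basisMonomials] at h
  rw [← Polynomial.monomial_one_right_eq_X_pow]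
  exact h

/-- `Asc (x, a) = ∏_{i = 1}^{a} ([i]_q + q ^ i x)`, for `a ≥ 0`. -/
def Asc (a : ℕ) : Kq[T;T⁻¹] :=
  ∏ i ∈ Finset.Icc 1 a,
    (LaurentPolynomial.C (qInt i) + LaurentPolynomial.C (q ^ i) * LaurentPolynomial.T 1)

/-- `Desc (x, -1) = - 1 / x` and `Desc (x, c) = ∏_{i = 1}^{c} ([i]_q - x)` for `c ≥ 0`
(only indices `c ≥ -1` are meaningful). -/
def Desc (c : ℤ) : Kq[T;T⁻¹] :=
  if c = -1 then - LaurentPolynomial.T (-1)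
  else ∏ i ∈ Finset.Icc 1 c.toNat, (LaurentPolynomial.C (qInt i) - LaurentPolynomial.T 1)

/-- `x ^ (m + 2) Asc (x, a - 1) Asc (x, b - 1) Desc (x, c - 1) Desc (x, d - 1)`, for `a, b ≥ 1`
and `c, d ≥ 0`, as a Laurent polynomial in `x`. -/
def laurentIntegrand (a b c d m : ℕ) : Kq[T;T⁻¹] :=
  LaurentPolynomial.T ((m : ℤ) + 2) * Asc (a - 1) * Asc (b - 1) * Desc ((c : ℤ) - 1)
    * Desc ((d : ℤ) - 1)

/-- The same element as a polynomial in `x`. It has no negative powers of `x`, so that the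
truncation loses nothing: see `toLaurent_integrand`. -/
def integrand (a b c d m : ℕ) : Kq[X] := LaurentPolynomial.trunc (laurentIntegrand a b c d m)

theorem Asc_mem_range (a : ℕ) : ∃ p : Kq[X], toLaurent p = Asc a := by
  refine ⟨∏ i ∈ Finset.Icc 1 a, (C (qInt i) + C (q ^ i) * X), ?_⟩
  simp [Asc, map_prod]

theorem T_mul_Desc_mem_range (c : ℕ) :
    ∃ p : Kq[X], toLaurent p = LaurentPolynomial.T 1 * Desc ((c : ℤ) - 1) := by
  rcases c with _ | c
  · refine ⟨-1, ?_⟩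
    have h : ((0 : ℕ) : ℤ) - 1 = -1 := rfl
    rw [h, Desc, if_pos rfl, mul_neg, ← LaurentPolynomial.T_add, add_neg_cancel,
      LaurentPolynomial.T_zero, map_neg, map_one]
  · refine ⟨X * ∏ i ∈ Finset.Icc 1 c, (C (qInt i) - X), ?_⟩
    have h : ((c + 1 : ℕ) : ℤ) - 1 = c := by push_cast; ring
    have h' : (c : ℤ) ≠ -1 := by omega
    rw [h, Desc, if_neg h', Int.toNat_natCast]
    simp [map_prod]

theorem toLaurent_integrand (a b c d m : ℕ) :
    toLaurent (integrand a b c d m) = laurentIntegrand a b c d m := by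
  obtain ⟨p₁, h₁⟩ := Asc_mem_range (a - 1)
  obtain ⟨p₂, h₂⟩ := Asc_mem_range (b - 1)
  obtain ⟨p₃, h₃⟩ := T_mul_Desc_mem_range c
  obtain ⟨p₄, h₄⟩ := T_mul_Desc_mem_range d
  have h : laurentIntegrand a b c d m = toLaurent (X ^ m * p₁ * p₂ * p₃ * p₄) := by
    have hT : (LaurentPolynomial.T ((m : ℤ) + 2) : Kq[T;T⁻¹])
        = LaurentPolynomial.T m * LaurentPolynomial.T 1 * LaurentPolynomial.T 1 := by
      rw [← LaurentPolynomial.T_add, ← LaurentPolynomial.T_add]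
      congr 1
    rw [map_mul, map_mul, map_mul, map_mul, h₁, h₂, h₃, h₄, Polynomial.toLaurent_X_pow,
      laurentIntegrand, hT]
    ring
  rw [integrand, h, Polynomial.trunc_toLaurent]

/-- `C_{a,b,c,d} = Ψ (x ^ 2 Asc (x, a - 1) Asc (x, b - 1) Desc (x, c - 1) Desc (x, d - 1))`. -/
def normConst (a b c d : ℕ) : Kq := Psi (integrand a b c d 0)

/-- The Hankel matrix `M(n)`, with rows and columns indexed by `0 ≤ i, j ≤ n - 1`. -/
def hankelMatrix (a b c d n : ℕ) : Matrix (Fin n) (Fin n) Kq :=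
  Matrix.of fun i j => Psi (integrand a b c d ((i : ℕ) + (j : ℕ)))

end

end QBernoulli

namespace QBernoulli

noncomputable section

/-! The Carlitz relations say that `Ψ` is invariant, up to a factor `q`, under `x ↦ 1 + q x` on
multiples of `x ^ 2` (`Psi_comp_of_X_sq_dvd`). This substitution carries the weight with parameters
`(a, b, c + 1, d + 1)` to a multiple of the one with `(a + 1, b + 1, c, d)`. Both are quadratic
multiples of the weight for `(a, b, c, d)`, so its moments of orders 0, 1, 2 satisfy a linear
relation (`secondMoment`). Induction on the parameters then gives the ratio of the first two moments
(`firstMoment`), hence the effect of raising `a` or `b`.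

Thus `Ψ` of the weight for `(a + i, b + j, c, d)` is a factor in `i`, times a factor in `j`, over a
`q`-rising factorial of length `i + j` (`Psi_weight_add`). Writing the Hankel determinant in the
bases `Asc (x, a + i) / Asc (x, a)` for rows and `Asc (x, b + j) / Asc (x, b)` for columns leaves
the determinant of inverse rising factorials, evaluated by row reduction (`det_invPochMatrix`). -/

/-- The `q`-integer `[n]_q` for a natural number `n`. -/
def qNat (n : ℕ) : Kq := (q ^ n - 1) / (q - 1)

theorem q_sub_one_ne_zero : q - 1 ≠ 0 := by
  simpa using q_pow_sub_one_ne_zero 0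

theorem q_ne_zero : q ≠ 0 := RatFunc.X_ne_zero

theorem qInt_natCast (n : ℕ) : qInt n = qNat n := by
  simp [qInt, qNat]

theorem qNat_mul (n : ℕ) : qNat n * (q - 1) = q ^ n - 1 :=
  div_mul_cancel₀ _ q_sub_one_ne_zero

theorem qNat_zero : qNat 0 = 0 := by simp [qNat]

theorem qNat_one : qNat 1 = 1 := by simp [qNat, q_sub_one_ne_zero]

theorem qNat_succ (n : ℕ) : qNat (n + 1) = 1 + q * qNat n := by
  apply mul_right_cancel₀ q_sub_one_ne_zero
  linear_combination qNat_mul (n + 1) - q * qNat_mul n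

theorem qNat_add (m n : ℕ) : qNat (m + n) = qNat m + q ^ m * qNat n := by
  apply mul_right_cancel₀ q_sub_one_ne_zero
  linear_combination qNat_mul (m + n) - qNat_mul m - q ^ m * qNat_mul n

theorem qNat_succ_ne_zero (n : ℕ) : qNat (n + 1) ≠ 0 :=
  div_ne_zero (q_pow_sub_one_ne_zero n) q_sub_one_ne_zero

/-! ### Functional equation of `Ψ`. -/

/-- The functional equation of `Ψ` under the substitution `x ↦ 1 + q x`. -/
theorem Psi_comp (f : Kq[X]) :
    q * Psi (f.comp (1 + C q * X)) - Psi f = (q - 1) * f.coeff 0 + f.coeff 1 := by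
  induction f using Polynomial.induction_on' with
  | add f g hf hg =>
    simp only [add_comp, map_add, coeff_add]
    linear_combination hf + hg
  | monomial n r =>
    have h : (monomial n r).comp (1 + C q * X) = r • ∑ k ∈ Finset.range (n + 1),
        ((n.choose k : Kq) * q ^ k) • (X : Kq[X]) ^ k := by
      rw [monomial_comp, add_comm (1 : Kq[X]), add_pow, smul_eq_C_mul]
      congr 1
      refine Finset.sum_congr rfl fun k _ => ?_
      rw [smul_eq_C_mul, map_mul, map_pow, map_natCast]
      ring
    have h2 : (monomial n r : Kq[X]) = r • X ^ n := by
      rw [smul_eq_C_mul, C_mul_X_pow_eq_monomial]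
    rw [h, map_smul, map_sum]
    simp only [map_smul, Psi_X_pow, smul_eq_mul]
    have hc := carlitz_relation n
    have hr : (q - 1) * (monomial n r).coeff 0 + (monomial n r : Kq[X]).coeff 1
        = r * carlitzRhs n := by
      rcases n with _ | _ | n <;> simp [carlitzRhs, coeff_monomial, mul_comm]
    rw [hr, h2, map_smul, Psi_X_pow, smul_eq_mul, ← hc]
    ring

/-- The boundary terms of `Psi_comp` involve only the coefficients of degrees 0 and 1. -/
theorem Psi_comp_of_X_sq_dvd (f : Kq[X]) : q * Psi ((X ^ 2 * f).comp (1 + C q * X))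
    = Psi (X ^ 2 * f) := by
  have h := Psi_comp (X ^ 2 * f)
  rw [coeff_X_pow_mul', coeff_X_pow_mul'] at h
  norm_num at h
  rw [mul_comp, pow_comp, X_comp]
  linear_combination h

/-! ### Weights, with `a`, `b` lowered by one from the theorem, and their shift. -/

/-- `Asc (x, a)` as a polynomial. -/
def ascPoly (a : ℕ) : Kq[X] := ∏ i ∈ Finset.range a, (C (qNat (i + 1)) + C (q ^ (i + 1)) * X)

/-- `- x Desc (x, c - 1)` as a polynomial. -/
def descPoly (c : ℕ) : Kq[X] := ∏ i ∈ Finset.range c, (C (qNat i) - X)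

/-- The weight `x ^ 2 Asc (x, a) Asc (x, b) Desc (x, c - 1) Desc (x, d - 1)` as a polynomial. -/
def weight (a b c d : ℕ) : Kq[X] := ascPoly a * ascPoly b * (descPoly c * descPoly d)

theorem ascPoly_succ (a : ℕ) :
    ascPoly (a + 1) = ascPoly a * (C (qNat (a + 1)) + C (q ^ (a + 1)) * X) :=
  Finset.prod_range_succ _ _

theorem descPoly_succ (c : ℕ) : descPoly (c + 1) = descPoly c * (C (qNat c) - X) :=
  Finset.prod_range_succ _ _

theorem weight_comm_asc (a b c d : ℕ) : weight a b c d = weight b a c d := by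
  simp only [weight]; ring

theorem weight_comm_desc (a b c d : ℕ) : weight a b c d = weight a b d c := by
  simp only [weight]; ring

theorem weight_succ_asc (a b c d : ℕ) : weight (a + 1) b c d
    = weight a b c d * (C (qNat (a + 1)) + C (q ^ (a + 1)) * X) := by
  simp only [weight, ascPoly_succ]; ring

theorem weight_succ_desc (a b c d : ℕ) : weight a b (c + 1) d
    = weight a b c d * (C (qNat c) - X) := by
  simp only [weight, descPoly_succ]; ring

/-- Each factor moves to the next one; `1 + q x` supplies the missing first factor. -/
theorem ascPoly_comp (a : ℕ) :
    (1 + C q * X) * (ascPoly a).comp (1 + C q * X) = ascPoly (a + 1) := by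
  rw [ascPoly, ascPoly, Finset.prod_range_succ', prod_comp, mul_comm]
  simp only [zero_add, qNat_one, pow_one, map_one]
  congr 1
  refine Finset.prod_congr rfl fun i _ => ?_
  simp only [add_comp, mul_comp, C_comp, X_comp, qNat_add (i + 1) 1, qNat_one, pow_succ, map_add,
    map_mul, map_one]
  ring

/-- Since `[i + 1]_q - (1 + q x) = q ([i]_q - x)`, the factors move down by one, and the factor `-x`
becomes `-(1 + q x)`, which `ascPoly_comp` can absorb. -/
theorem descPoly_comp (c : ℕ) : (descPoly (c + 1)).comp (1 + C q * X)
    = -(1 + C q * X) * C (q ^ c) * descPoly c := by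
  rw [descPoly, descPoly, Finset.prod_range_succ', mul_comp, prod_comp]
  have h : ∏ i ∈ Finset.range c, (C (qNat (i + 1)) - X : Kq[X]).comp (1 + C q * X)
      = C (q ^ c) * ∏ i ∈ Finset.range c, (C (qNat i) - X) := by
    rw [map_pow, ← Finset.card_range c, ← Finset.prod_const, Finset.card_range,
      ← Finset.prod_mul_distrib]
    refine Finset.prod_congr rfl fun i _ => ?_
    rw [sub_comp, C_comp, X_comp, qNat_succ, map_add, map_mul, map_one]
    ring
  rw [h]
  simp only [qNat_zero, map_zero, zero_sub, neg_comp, X_comp]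
  ring

theorem X_sq_dvd_weight (a b c d : ℕ) : X ^ 2 ∣ weight a b (c + 1) (d + 1) := by
  have h (c : ℕ) : X ∣ descPoly (c + 1) := by
    refine Dvd.dvd.trans ?_ (Finset.dvd_prod_of_mem _ (Finset.mem_range.2 c.succ_pos))
    simp [qNat_zero]
  rw [weight, sq]
  exact (mul_dvd_mul (h c) (h d)).mul_left _

theorem weight_comp (a b c d : ℕ) : (weight a b (c + 1) (d + 1)).comp (1 + C q * X)
    = C (q ^ (c + d)) * weight (a + 1) (b + 1) c d := by
  rw [weight, weight, mul_comp, mul_comp, mul_comp, descPoly_comp, descPoly_comp, ← ascPoly_comp a,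
    ← ascPoly_comp b, pow_add, map_mul]
  ring

theorem Psi_C_mul (r : Kq) (f : Kq[X]) : Psi (C r * f) = r * Psi f := by
  rw [← smul_eq_C_mul, map_smul, smul_eq_mul]

theorem Psi_weight_shift (a b c d : ℕ) :
    q ^ (c + d + 1) * Psi (weight (a + 1) (b + 1) c d) = Psi (weight a b (c + 1) (d + 1)) := by
  obtain ⟨f, hf⟩ := X_sq_dvd_weight a b c d
  have h := Psi_comp_of_X_sq_dvd f
  rw [← hf, weight_comp, Psi_C_mul] at h
  rw [← h]
  ring

theorem Psi_mul_linear (f : Kq[X]) (r s : Kq) :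
    Psi (f * (C r + C s * X)) = r * Psi f + s * Psi (f * X) := by
  rw [show f * (C r + C s * X) = C r * f + C s * (f * X) by ring, map_add, Psi_C_mul, Psi_C_mul]

theorem Psi_mul_linear' (f : Kq[X]) (r : Kq) :
    Psi (f * (C r - X)) = r * Psi f - Psi (f * X) := by
  rw [show f * (C r - X) = C r * f - f * X by ring, map_sub, Psi_C_mul]

/-! ### First moments and the product formula. -/

/-- The first moment of the linear form `f ↦ Ψ (f W)`, where `W` is a weight. -/
def FirstMoment (a b c d : ℕ) : Prop :=
  (q - 1) * (q ^ (a + b + c + d + 2) - 1) * Psi (weight a b c d * X)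
    = (q ^ (a + 1) * q ^ c * q ^ d + q ^ (b + 1) * q ^ c * q ^ d - q ^ c - q ^ d
      - q ^ (a + 1) * q ^ (b + 1) * q ^ c * q ^ d + 1) * Psi (weight a b c d)

/-- This is `Psi_weight_shift` with both sides expanded over the weight for `(a, b, c, d)`, cleared
of denominators by `(q - 1) ^ 2`. -/
theorem secondMoment (a b c d : ℕ) :
    q ^ (c + d + 1) * ((q ^ (a + 1) - 1) * (q ^ (b + 1) - 1) * Psi (weight a b c d)
      + ((q ^ (a + 1) - 1) * q ^ (b + 1) + (q ^ (b + 1) - 1) * q ^ (a + 1)) * (q - 1)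
        * Psi (weight a b c d * X)
      + q ^ (a + 1) * q ^ (b + 1) * (q - 1) ^ 2 * Psi (weight a b c d * X * X))
    = (q ^ c - 1) * (q ^ d - 1) * Psi (weight a b c d)
      - (q ^ c - 1 + (q ^ d - 1)) * (q - 1) * Psi (weight a b c d * X)
      + (q - 1) ^ 2 * Psi (weight a b c d * X * X) := by
  have h := Psi_weight_shift a b c d
  rw [weight_comm_asc, weight_succ_asc, weight_comm_asc, weight_succ_asc, weight_succ_desc,
    weight_comm_desc a b c (d + 1), weight_succ_desc, weight_comm_desc a b d c, Psi_mul_linear, Psi_mul_linear',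
    mul_right_comm _ _ X, mul_right_comm _ _ X, Psi_mul_linear, Psi_mul_linear, Psi_mul_linear',
    Psi_mul_linear'] at h
  simp only [← qNat_mul]
  linear_combination (q - 1) ^ 2 * h

/-- The new first moment involves the old second one. The coefficient of the latter in
`secondMoment` is `(q - 1) ^ 2 (q ^ (a + b + c + d + 3) - 1)`, matching the new prefactor, so it is
eliminated without division. -/
theorem FirstMoment.succ_asc {a b c d : ℕ} (h : FirstMoment a b c d) :
    FirstMoment (a + 1) b c d := by
  have h2 := secondMoment a b c d
  have ha := qNat_mul (a + 1)
  rw [FirstMoment] at h ⊢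
  apply mul_right_cancel₀ q_sub_one_ne_zero
  rw [weight_succ_asc, mul_right_comm _ _ X, Psi_mul_linear, Psi_mul_linear]
  linear_combination q ^ (a + 1) * h2 - h + ((q - 1) * (q ^ (a + b + c + d + 3) - 1) * Psi (weight a b c d * X)
    - (q ^ (a + 2) * q ^ c * q ^ d + q ^ (b + 1) * q ^ c * q ^ d - q ^ c - q ^ d
      - q ^ (a + 2) * q ^ (b + 1) * q ^ c * q ^ d + 1) * Psi (weight a b c d)) * ha

theorem FirstMoment.comm_asc {a b c d : ℕ} (h : FirstMoment a b c d) : FirstMoment b a c d := by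
  rw [FirstMoment] at h ⊢
  rw [weight_comm_asc, add_comm b a]
  linear_combination h

theorem FirstMoment.comm_desc {a b c d : ℕ} (h : FirstMoment a b c d) : FirstMoment a b d c := by
  rw [FirstMoment] at h ⊢
  rw [weight_comm_desc, add_right_comm _ d c]
  linear_combination h

theorem FirstMoment.succ_desc {a b c d : ℕ} (h : FirstMoment a b c d) :
    FirstMoment a b (c + 1) d := by
  have h2 := secondMoment a b c d
  have ha := qNat_mul c
  rw [FirstMoment] at h ⊢
  apply mul_right_cancel₀ q_sub_one_ne_zero
  rw [weight_succ_desc, mul_right_comm _ _ X, Psi_mul_linear', Psi_mul_linear']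
  linear_combination q ^ (c + 1) * h - h2 + ((q - 1) * (q ^ (a + b + c + d + 3) - 1) * Psi (weight a b c d * X)
    - (q ^ (a + 1) * q ^ (c + 1) * q ^ d + q ^ (b + 1) * q ^ (c + 1) * q ^ d - q ^ (c + 1) - q ^ d
      - q ^ (a + 1) * q ^ (b + 1) * q ^ (c + 1) * q ^ d + 1) * Psi (weight a b c d)) * ha

theorem beta_zero : beta 0 = 1 := by
  have h := carlitz_relation 0
  apply mul_right_cancel₀ q_sub_one_ne_zero
  simp [carlitzRhs] at h
  linear_combination h

theorem firstMoment_zero : FirstMoment 0 0 0 0 := by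
  have h := carlitz_relation 1
  have hw : weight 0 0 0 0 = 1 := by simp [weight, ascPoly, descPoly]
  have h0 := Psi_X_pow 0
  have h1 := Psi_X_pow 1
  rw [pow_zero, beta_zero] at h0
  rw [pow_one] at h1
  simp [Finset.sum_range_succ, carlitzRhs, beta_zero] at h
  rw [FirstMoment, hw, one_mul, h0, h1]
  linear_combination (q - 1) * h

theorem firstMoment (a b c d : ℕ) : FirstMoment a b c d := by
  have h1 (a : ℕ) : FirstMoment a 0 0 0 := by
    induction a with
    | zero => exact firstMoment_zero
    | succ a ih => exact ih.succ_asc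
  have h2 (a b : ℕ) : FirstMoment a b 0 0 := by
    induction b with
    | zero => exact h1 a
    | succ b ih => exact ih.comm_asc.succ_asc.comm_asc
  have h3 (a b c : ℕ) : FirstMoment a b c 0 := by
    induction c with
    | zero => exact h2 a b
    | succ c ih => exact ih.succ_desc
  induction d with
  | zero => exact h3 a b c
  | succ d ih => exact ih.comm_desc.succ_desc.comm_desc

/-- Raising `a` multiplies the weight by a linear factor, so `firstMoment` gives the ratio, whose
numerator happens to factor. -/
theorem Psi_weight_succ (a b c d : ℕ) :
    qNat (a + b + c + d + 2) * Psi (weight (a + 1) b c d)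
      = qNat (a + 1 + c) * qNat (a + 1 + d) * Psi (weight a b c d) := by
  have h := firstMoment a b c d
  rw [FirstMoment] at h
  have hv := pow_ne_zero 2 q_sub_one_ne_zero
  rw [weight_succ_asc, Psi_mul_linear]
  apply mul_right_cancel₀ hv
  linear_combination q ^ (a + 1) * h
    + (qNat (a + 1) * Psi (weight a b c d) + q ^ (a + 1) * Psi (weight a b c d * X)) * (q - 1)
      * qNat_mul (a + b + c + d + 2)
    + (q ^ (a + b + c + d + 2) - 1) * Psi (weight a b c d) * qNat_mul (a + 1)
    - Psi (weight a b c d) * (q - 1) * qNat (a + 1 + d) * qNat_mul (a + 1 + c)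
    - Psi (weight a b c d) * (q ^ (a + 1 + c) - 1) * qNat_mul (a + 1 + d)

/-- The `q`-rising factorial `[s]_q [s + 1]_q ⋯ [s + n - 1]_q`. -/
def qPoch (s n : ℕ) : Kq := ∏ k ∈ Finset.range n, qNat (s + k)

theorem qPoch_zero (s : ℕ) : qPoch s 0 = 1 := rfl

theorem qPoch_succ (s n : ℕ) : qPoch s (n + 1) = qPoch s n * qNat (s + n) :=
  Finset.prod_range_succ _ _

theorem qPoch_add (s m n : ℕ) : qPoch s (m + n) = qPoch s m * qPoch (s + m) n := by
  simp only [qPoch, Finset.prod_range_add, add_assoc]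

theorem qPoch_succ_ne_zero (s n : ℕ) : qPoch (s + 1) n ≠ 0 :=
  Finset.prod_ne_zero_iff.2 fun k _ => by
    rw [add_right_comm]
    exact qNat_succ_ne_zero _

theorem Psi_weight_add_left (a b c d i : ℕ) :
    Psi (weight (a + i) b c d) * qPoch (a + b + c + d + 2) i
      = Psi (weight a b c d) * (qPoch (a + 1 + c) i * qPoch (a + 1 + d) i) := by
  induction i with
  | zero => simp [qPoch_zero]
  | succ i ih =>
    have h := Psi_weight_succ (a + i) b c d
    rw [show a + i + b + c + d + 2 = a + b + c + d + 2 + i by ring,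
      show a + i + 1 + c = a + 1 + c + i by ring, show a + i + 1 + d = a + 1 + d + i by ring] at h
    rw [qPoch_succ, qPoch_succ, qPoch_succ, ← add_assoc]
    linear_combination qPoch (a + b + c + d + 2) i * h
      + qNat (a + 1 + c + i) * qNat (a + 1 + d + i) * ih

theorem Psi_weight_add (a b c d i j : ℕ) :
    Psi (weight (a + i) (b + j) c d)
      = Psi (weight a b c d) * (qPoch (a + 1 + c) i * qPoch (a + 1 + d) i)
        * (qPoch (b + 1 + c) j * qPoch (b + 1 + d) j) * (qPoch (a + b + c + d + 2) (i + j))⁻¹ := by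
  rw [eq_mul_inv_iff_mul_eq₀ (qPoch_succ_ne_zero _ _), ← Psi_weight_add_left, qPoch_add]
  have h := Psi_weight_add_left b (a + i) c d j
  rw [weight_comm_asc, weight_comm_asc b,
    show b + (a + i) + c + d + 2 = a + b + c + d + 2 + i by ring] at h
  linear_combination qPoch (a + b + c + d + 2) i * h

/-! ### Staircase products. -/

/-- `u_0 ^ m u_1 ^ (m - 1) ⋯ u_{m - 1}`. -/
def stairProd (u : ℕ → Kq) (m : ℕ) : Kq := ∏ k ∈ Finset.range m, u k ^ (m - k)

theorem stairProd_zero (u : ℕ → Kq) : stairProd u 0 = 1 := rfl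

theorem stairProd_succ (u : ℕ → Kq) (m : ℕ) :
    stairProd u (m + 1) = stairProd u m * ∏ k ∈ Finset.range (m + 1), u k := by
  rw [stairProd, stairProd, Finset.prod_range_succ, Finset.prod_range_succ, ← mul_assoc,
    ← Finset.prod_mul_distrib]
  congr 1
  · refine Finset.prod_congr rfl fun k hk => ?_
    rw [Nat.succ_sub (Finset.mem_range.1 hk).le, pow_succ]
  · simp

theorem stairProd_succ' (u : ℕ → Kq) (m : ℕ) :
    stairProd u (m + 1) = u 0 ^ (m + 1) * stairProd (fun k => u (k + 1)) m := by
  rw [stairProd, stairProd, Finset.prod_range_succ', mul_comm]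
  simp

theorem stairProd_mul (u v : ℕ → Kq) (m : ℕ) :
    stairProd (fun k => u k * v k) m = stairProd u m * stairProd v m := by
  simp only [stairProd, mul_pow, Finset.prod_mul_distrib]

theorem prod_prod_range_eq_stairProd (u : ℕ → Kq) (m : ℕ) :
    ∏ i ∈ Finset.range (m + 1), ∏ k ∈ Finset.range i, u k = stairProd u m := by
  induction m with
  | zero => simp [stairProd_zero]
  | succ m ih => rw [Finset.prod_range_succ, ih, stairProd_succ]

theorem prod_geom (x y : Kq) (m : ℕ) :
    ∏ k ∈ Finset.range m, (x * y ^ k) = x ^ m * y ^ m.choose 2 := by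
  induction m with
  | zero => simp
  | succ m ih =>
    rw [Finset.prod_range_succ, ih, Nat.choose_succ_succ' m 1, Nat.choose_one_right]
    ring

theorem stairProd_geom (x y : Kq) (m : ℕ) :
    stairProd (fun k => x * y ^ k) m = x ^ (m + 1).choose 2 * y ^ (m + 1).choose 3 := by
  induction m with
  | zero => simp [stairProd_zero, Nat.choose_eq_zero_of_lt]
  | succ m ih =>
    rw [stairProd_succ, ih, prod_geom, Nat.choose_succ_succ' (m + 1) 1, Nat.choose_one_right,
      Nat.choose_succ_succ' (m + 1) 2]
    ring

/-- Up to sign and powers of `q`, the recurrence coefficients of the Hankel determinants of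
`1 / [s]_q ⋯ [s + n - 1]_q`, with `s = t + 2`. -/
def recCoeff (t k : ℕ) : Kq :=
  qNat (k + 1) * qNat (t + k + 1)
    / (qNat (t + 2 * k + 1) * qNat (t + 2 * k + 2) ^ 2 * qNat (t + 2 * k + 3))

/-- With `g k = [k + 1]_q / [t + 2 + k]_q`, the shifted coefficients `recCoeff t (k + 1)` differ
from `recCoeff (t + 2) k` by `g (k + 1) / g k`. The staircase product of these ratios telescopes. -/
theorem stairProd_recCoeff (t m : ℕ) :
    stairProd (recCoeff t) (m + 1) = (qNat (t + 2) * qNat (t + 3))⁻¹ ^ (m + 1)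
      * (∏ k ∈ Finset.range (m + 1), (qNat (k + 1) / qNat (t + 2 + k)))
      * stairProd (recCoeff (t + 2)) m := by
  set g : ℕ → Kq := fun k => qNat (k + 1) / qNat (t + 2 + k) with hg
  have hne (k : ℕ) : g k ≠ 0 := by
    refine div_ne_zero (qNat_succ_ne_zero _) ?_
    rw [show t + 2 + k = t + 1 + k + 1 by ring]
    exact qNat_succ_ne_zero _
  have h1 (k : ℕ) : recCoeff t (k + 1) * g k = recCoeff (t + 2) k * g (k + 1) := by
    simp only [recCoeff, hg]
    rw [show t + (k + 1) + 1 = t + 1 + k + 1 by ring,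
      show t + 2 * (k + 1) + 1 = t + 2 + 2 * k + 1 by ring,
      show t + 2 * (k + 1) + 2 = t + 2 + 2 * k + 2 by ring,
      show t + 2 * (k + 1) + 3 = t + 2 + 2 * k + 3 by ring,
      show t + 2 + k = t + 1 + k + 1 by ring, show t + 2 + (k + 1) = t + 1 + k + 1 + 1 by ring]
    have := qNat_succ_ne_zero (t + 1 + k)
    have := qNat_succ_ne_zero (t + 1 + k + 1)
    field_simp
  have h2 : recCoeff t 0 = (qNat (t + 2) * qNat (t + 3))⁻¹ * g 0 := by
    simp only [recCoeff, hg, zero_add, add_zero, mul_zero, qNat_one]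
    have := qNat_succ_ne_zero t
    have := qNat_succ_ne_zero (t + 1)
    have := qNat_succ_ne_zero (t + 2)
    field_simp
  have h3 : stairProd (fun k => recCoeff t (k + 1)) m * stairProd g m
      = stairProd (recCoeff (t + 2)) m * stairProd (fun k => g (k + 1)) m := by
    rw [← stairProd_mul, ← stairProd_mul]
    simp only [h1]
  have h4 : stairProd g m ≠ 0 := Finset.prod_ne_zero_iff.2 fun k _ => pow_ne_zero _ (hne k)
  have h5 := (stairProd_succ g m).symm.trans (stairProd_succ' g m)
  apply mul_right_cancel₀ h4
  rw [stairProd_succ', h2, mul_pow]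
  linear_combination (qNat (t + 2) * qNat (t + 3))⁻¹ ^ (m + 1) * g 0 ^ (m + 1) * h3
    - (qNat (t + 2) * qNat (t + 3))⁻¹ ^ (m + 1) * stairProd (recCoeff (t + 2)) m * h5

/-! ### Hankel determinant of inverse `q`-rising factorials. -/

/-- The Hankel matrix of the sequence `1 / [s]_q ⋯ [s + n - 1]_q`. -/
def invPochMatrix (s n : ℕ) : Matrix (Fin n) (Fin n) Kq :=
  Matrix.of fun i j => (qPoch s (i + j : ℕ))⁻¹

theorem det_invPochMatrix_succ (s m : ℕ) :
    (invPochMatrix (s + 1) (m + 2)).det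
      = (∏ i ∈ Finset.range (m + 1), (-q ^ (s + 1) * q ^ i))
        * (qNat (s + 1) * qNat (s + 2))⁻¹ ^ (m + 1)
        * (∏ k ∈ Finset.range (m + 1), (qNat (k + 1) / qNat (s + 1 + k)))
        * (invPochMatrix (s + 3) (m + 1)).det := by
  set u : ℕ → Kq := fun i =>
    -q ^ (s + 1) * q ^ i * (qNat (s + 1) * qNat (s + 2))⁻¹ * (qNat (s + 1 + i))⁻¹ with hu
  have hs (i : ℕ) : qNat (s + 1 + i) ≠ 0 := by
    rw [add_right_comm]
    exact qNat_succ_ne_zero _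
  -- Row `i + 1` minus `1 / [s + 1 + i]_q` times row `i`. The factor `[j]_q` clears the first column
  -- below the top; the remaining minor is a rescaled matrix of the same type with `s + 1` raised by
  -- 2.
  set B : Matrix (Fin (m + 2)) (Fin (m + 2)) Kq := Matrix.of
    (Fin.cons (fun j => (qPoch (s + 1) j)⁻¹)
      (fun (i : Fin (m + 1)) j => -(q ^ (s + 1 + i) / qNat (s + 1 + i)) * qNat j
        * (qPoch (s + 1) (i + j + 1))⁻¹)) with hB
  have h1 : (invPochMatrix (s + 1) (m + 2)).det = B.det := by
    refine Matrix.det_eq_of_forall_row_eq_smul_add_pred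
      (fun i : Fin (m + 1) => (qNat (s + 1 + i))⁻¹) (fun j => ?_) (fun i j => ?_)
    · simp [invPochMatrix, hB]
    · simp only [invPochMatrix, hB, Matrix.of_apply, Fin.cons_succ, Fin.val_succ, Fin.val_castSucc]
      have h2 := qPoch_succ_ne_zero s (i + j)
      have h3 := hs i
      have h4 := hs (i + j)
      have h5 := qNat_add (s + 1 + i) j
      rw [show (i : ℕ) + 1 + j = i + j + 1 by ring, qPoch_succ]
      rw [add_assoc] at h5
      field_simp
      linear_combination -h5
  have h2 : B.submatrix (Fin.succAbove 0) Fin.succ = Matrix.of fun i j : Fin (m + 1) =>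
      u i * (Matrix.of fun i j : Fin (m + 1) =>
        qNat (j + 1) * invPochMatrix (s + 3) (m + 1) i j) i j := by
    ext i j
    simp only [hB, hu, invPochMatrix, Matrix.submatrix_apply, Matrix.of_apply, Fin.succAbove_zero,
      Fin.cons_succ, Fin.val_succ]
    rw [show (i : ℕ) + (j + 1) + 1 = 2 + (i + j) by ring, qPoch_add, pow_add q (s + 1)]
    simp only [qPoch, Finset.prod_range_succ, Finset.prod_range_zero, add_zero, mul_inv]
    ring
  have h3 : (∏ i : Fin (m + 1), u i) * ∏ j : Fin (m + 1), qNat (j + 1)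
      = (∏ i ∈ Finset.range (m + 1), (-q ^ (s + 1) * q ^ i))
        * (qNat (s + 1) * qNat (s + 2))⁻¹ ^ (m + 1)
        * (∏ k ∈ Finset.range (m + 1), (qNat (k + 1) / qNat (s + 1 + k))) := by
    rw [Fin.prod_univ_eq_prod_range u, Fin.prod_univ_eq_prod_range (fun j => qNat (j + 1)), hu,
      Finset.prod_mul_distrib, Finset.prod_mul_distrib, Finset.prod_const, Finset.card_range]
    simp only [div_eq_mul_inv (qNat _)]
    rw [Finset.prod_mul_distrib (f := fun k => qNat (k + 1))]
    ring
  rw [h1, Matrix.det_succ_column_zero, Fin.sum_univ_succ, Finset.sum_eq_zero, h2,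
    Matrix.det_mul_column, Matrix.det_mul_row, ← h3]
  · simp [hB, qPoch_zero]
    ring
  · intro i _
    simp [hB, qNat_zero]

theorem det_invPochMatrix (t m : ℕ) :
    (invPochMatrix (t + 2) (m + 1)).det
      = (-q ^ (t + 2)) ^ (m + 1).choose 2 * q ^ (3 * (m + 1).choose 3)
        * stairProd (recCoeff t) m := by
  induction m generalizing t with
  | zero => simp [invPochMatrix, qPoch_zero, stairProd_zero, Nat.choose_eq_zero_of_lt]
  | succ m ih =>
    rw [det_invPochMatrix_succ, ih (t + 2), prod_geom, stairProd_recCoeff,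
      Nat.choose_succ_succ' (m + 1) 1, Nat.choose_one_right, Nat.choose_succ_succ' (m + 1) 2,
      show -q ^ (t + 2 + 2) = -q ^ (t + 2) * q ^ 2 by ring, mul_pow]
    ring

/-! ### Change of basis and the determinant for a weight. -/

/-- Change of basis in a Hankel determinant. -/
theorem det_hankel_basis {K : Type*} [Field K] (L : K[X] →ₗ[K] K) (p r : ℕ → K[X])
    (hp : ∀ i, (p i).natDegree ≤ i) (hr : ∀ i, (r i).natDegree ≤ i) (n : ℕ) :
    (Matrix.of fun i j : Fin n => L (p i * r j)).det
      = (∏ i ∈ Finset.range n, (p i).coeff i) * (∏ i ∈ Finset.range n, (r i).coeff i)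
        * (Matrix.of fun i j : Fin n => L (X ^ (i + j : ℕ))).det := by
  have key (p : ℕ → K[X]) (hp : ∀ i, (p i).natDegree ≤ i) :
      (Matrix.of fun i k : Fin n => (p i).coeff k).det
        = ∏ i ∈ Finset.range n, (p i).coeff i := by
    rw [Matrix.det_of_isLowerTriangular, ← Fin.prod_univ_eq_prod_range (fun i => (p i).coeff i)]
    · rfl
    · intro i j hij
      exact coeff_eq_zero_of_natDegree_lt ((hp i).trans_lt hij)
  have expand (p : ℕ → K[X]) (hp : ∀ i, (p i).natDegree ≤ i) (i : Fin n) :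
      p i = ∑ k : Fin n, C ((p i).coeff k) * X ^ (k : ℕ) := by
    rw [Fin.sum_univ_eq_sum_range (fun k => C ((p i).coeff k) * X ^ k)]
    exact as_sum_range_C_mul_X_pow' _ ((hp i).trans_lt i.2)
  have h : (Matrix.of fun i j : Fin n => L (p i * r j))
      = (Matrix.of fun i k : Fin n => (p i).coeff k)
        * (Matrix.of fun i j : Fin n => L (X ^ (i + j : ℕ)))
        * (Matrix.of fun i k : Fin n => (r i).coeff k).transpose := by
    ext i j
    simp only [Matrix.mul_apply, Matrix.of_apply, Matrix.transpose_apply]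
    conv_lhs => rw [expand p hp i, expand r hr j]
    rw [Finset.mul_sum, map_sum]
    refine Finset.sum_congr rfl fun l _ => ?_
    rw [Finset.sum_mul, Finset.sum_mul, map_sum]
    refine Finset.sum_congr rfl fun k _ => ?_
    rw [show C ((p i).coeff k) * X ^ (k : ℕ) * (C ((r j).coeff l) * X ^ (l : ℕ))
      = C ((p i).coeff k * (r j).coeff l) * X ^ (k + l : ℕ) by rw [map_mul]; ring,
      ← smul_eq_C_mul, map_smul, smul_eq_mul]
    ring
  rw [h, Matrix.det_mul, Matrix.det_mul, Matrix.det_transpose, key p hp, key r hr]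
  ring

/-- `Asc (x, a + i) / Asc (x, a)` as a polynomial. -/
def ascShift (a i : ℕ) : Kq[X] :=
  ∏ k ∈ Finset.range i, (C (qNat (a + k + 1)) + C (q ^ (a + k + 1)) * X)

theorem ascPoly_add (a i : ℕ) : ascPoly (a + i) = ascPoly a * ascShift a i :=
  Finset.prod_range_add _ _ _

theorem natDegree_ascShift_le (a i : ℕ) : (ascShift a i).natDegree ≤ i := by
  refine (natDegree_prod_le _ _).trans ?_
  refine (Finset.sum_le_card_nsmul _ _ 1 fun k _ => ?_).trans (by simp)
  rw [add_comm]
  exact natDegree_linear_le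

theorem coeff_ascShift (a i : ℕ) :
    (ascShift a i).coeff i = ∏ k ∈ Finset.range i, (q ^ (a + 1) * q ^ k) := by
  have h := coeff_prod_of_natDegree_le (s := Finset.range i)
    (fun k => C (qNat (a + k + 1)) + C (q ^ (a + k + 1)) * X) 1 (fun k _ => by
      rw [add_comm]
      exact natDegree_linear_le)
  rw [Finset.card_range, mul_one] at h
  rw [ascShift, h]
  refine Finset.prod_congr rfl fun k _ => ?_
  rw [coeff_add, coeff_C_mul, coeff_X_one, coeff_C_succ, ← pow_add]
  ring

theorem prod_coeff_ascShift (a m : ℕ) :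
    ∏ i ∈ Finset.range (m + 1), (ascShift a i).coeff i
      = (q ^ (a + 1)) ^ (m + 1).choose 2 * q ^ (m + 1).choose 3 := by
  simp only [coeff_ascShift, prod_prod_range_eq_stairProd, stairProd_geom]

theorem prod_qPoch (s m : ℕ) : ∏ i : Fin (m + 1), qPoch s i
    = stairProd (fun k => qNat (s + k)) m := by
  rw [Fin.prod_univ_eq_prod_range (qPoch s), ← prod_prod_range_eq_stairProd]
  rfl

theorem det_weight (a b c d m : ℕ) :
    (Matrix.of fun i j : Fin (m + 1) => Psi (weight a b c d * X ^ (i + j : ℕ))).det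
      = (-q ^ (c + d)) ^ (m + 1).choose 2 * q ^ (m + 1).choose 3
        * Psi (weight a b c d) ^ (m + 1)
        * stairProd (fun k => qNat (a + 1 + c + k) * qNat (a + 1 + d + k)
          * (qNat (b + 1 + c + k) * qNat (b + 1 + d + k)) * recCoeff (a + b + c + d) k) m := by
  have h := det_hankel_basis (Psi.comp (LinearMap.mulLeft Kq (weight a b c d))) (ascShift a)
    (ascShift b) (natDegree_ascShift_le a) (natDegree_ascShift_le b) (m + 1)
  have h2 : (Matrix.of fun i j : Fin (m + 1) =>
      (Psi.comp (LinearMap.mulLeft Kq (weight a b c d))) (ascShift a i * ascShift b j))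
      = Matrix.of fun i j : Fin (m + 1) =>
        (Psi (weight a b c d) * (qPoch (a + 1 + c) i * qPoch (a + 1 + d) i))
        * (Matrix.of fun i j : Fin (m + 1) => (qPoch (b + 1 + c) j * qPoch (b + 1 + d) j)
          * invPochMatrix (a + b + c + d + 2) (m + 1) i j) i j := by
    ext i j
    simp only [Matrix.of_apply, LinearMap.comp_apply, LinearMap.mulLeft_apply, invPochMatrix]
    refine Eq.trans ?_ ((Psi_weight_add a b c d i j).trans (by ring))
    congr 1
    simp only [weight, ascPoly_add]
    ring
  rw [h2, Matrix.det_mul_column, Matrix.det_mul_row, det_invPochMatrix, prod_coeff_ascShift,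
    prod_coeff_ascShift, Finset.prod_mul_distrib, Finset.prod_mul_distrib,
    Finset.prod_mul_distrib, prod_qPoch, prod_qPoch, prod_qPoch, prod_qPoch, Finset.prod_const,
    Finset.card_univ, Fintype.card_fin] at h
  simp only [LinearMap.comp_apply, LinearMap.mulLeft_apply] at h
  rw [stairProd_mul, stairProd_mul, stairProd_mul, stairProd_mul]
  have hq := q_ne_zero
  -- The leading coefficients of the two bases. Cancelling them turns `-q ^ (a + b + c + d + 2)`
  -- into `-q ^ (c + d)` and removes two of the three factors `q ^ (m + 1).choose 3`.
  have h3 : ((q ^ (a + 1)) ^ (m + 1).choose 2 * q ^ (m + 1).choose 3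
      * ((q ^ (b + 1)) ^ (m + 1).choose 2 * q ^ (m + 1).choose 3)) ≠ 0 := by positivity
  apply mul_left_cancel₀ h3
  rw [← h, show -q ^ (a + b + c + d + 2) = q ^ (a + 1) * q ^ (b + 1) * -q ^ (c + d) by ring,
    mul_pow, mul_pow]
  ring

/-! ### Return to Laurent polynomials. -/

theorem toLaurent_ascPoly (a : ℕ) : toLaurent (ascPoly a) = Asc a := by
  rw [Asc, ascPoly, map_prod]
  induction a with
  | zero => simp
  | succ a ih =>
    rw [Finset.prod_range_succ, ih, Finset.prod_Icc_succ_top (by omega), ← qInt_natCast]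
    simp

theorem toLaurent_descPoly (c : ℕ) :
    toLaurent (descPoly c) = -(LaurentPolynomial.T 1 * Desc ((c : ℤ) - 1)) := by
  rcases c with _ | c
  · have h : ((0 : ℕ) : ℤ) - 1 = -1 := rfl
    rw [h, Desc, if_pos rfl, mul_neg, ← LaurentPolynomial.T_add]
    simp [descPoly]
  · have h : ((c + 1 : ℕ) : ℤ) - 1 = c := by push_cast; ring
    rw [h, Desc, if_neg (by omega), Int.toNat_natCast, descPoly, Finset.prod_range_succ', map_mul,
      mul_comm, qNat_zero, map_zero, zero_sub, map_neg, toLaurent_X, neg_mul, map_prod]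
    congr 2
    induction c with
    | zero => simp
    | succ c ih =>
      rw [Finset.prod_range_succ, ih (by push_cast; ring), Finset.prod_Icc_succ_top (by omega),
        ← qInt_natCast]
      simp

/-- The signs of the two factors `-x Desc` cancel. -/
theorem integrand_eq (a b c d m : ℕ) :
    integrand (a + 1) (b + 1) c d m = weight a b c d * X ^ m := by
  have h : laurentIntegrand (a + 1) (b + 1) c d m = toLaurent (weight a b c d * X ^ m) := by
    rw [weight, map_mul, map_mul, map_mul, map_mul, toLaurent_ascPoly, toLaurent_ascPoly,
      toLaurent_descPoly, toLaurent_descPoly, toLaurent_X_pow, laurentIntegrand,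
      show (m : ℤ) + 2 = 1 + 1 + m by ring, LaurentPolynomial.T_add, LaurentPolynomial.T_add,
      Nat.add_sub_cancel, Nat.add_sub_cancel]
    ring
  rw [integrand, h, Polynomial.trunc_toLaurent]
end
end QBernoulli

theorem mainTheorem11 (a b c d n : ℕ) (ha : 1 ≤ a) (hb : 1 ≤ b) :
    (QBernoulli.hankelMatrix a b c d n).det =
      (-QBernoulli.q ^ (c + d)) ^ (n.choose 2) * QBernoulli.q ^ (n.choose 3)
        * QBernoulli.normConst a b c d ^ n
        * ∏ i ∈ Finset.Ico 1 n,
            ((QBernoulli.qInt i * QBernoulli.qInt (a + c + i - 1)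
                * QBernoulli.qInt (b + c + i - 1) * QBernoulli.qInt (a + d + i - 1)
                * QBernoulli.qInt (b + d + i - 1) * QBernoulli.qInt (a + b + c + d + i - 2))
              / (QBernoulli.qInt (a + b + c + d + 2 * i - 3)
                * QBernoulli.qInt (a + b + c + d + 2 * i - 2) ^ 2
                * QBernoulli.qInt (a + b + c + d + 2 * i - 1))) ^ (n - i) := by
  obtain ⟨a, rfl⟩ := Nat.exists_eq_add_of_le' ha
  obtain ⟨b, rfl⟩ := Nat.exists_eq_add_of_le' hb
  rcases n with _ | m
  · simp
  have h := QBernoulli.det_weight a b c d m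
  simp only [QBernoulli.hankelMatrix, QBernoulli.normConst, QBernoulli.integrand_eq, pow_zero,
    mul_one]
  rw [h, Finset.prod_Ico_eq_prod_range, Nat.add_sub_cancel, QBernoulli.stairProd]
  congr 1
  refine Finset.prod_congr rfl fun k _ => ?_
  rw [show m + 1 - (1 + k) = m - k by omega]
  congr 1
  simp only [QBernoulli.recCoeff, ← QBernoulli.qInt_natCast]
  rw [mul_div_assoc']
  congr 1
  · push_cast
    ring_nf
  · push_cast
    ring_nf
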